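/- All Hilbert spaces are finite-dimensional, $\mathcal B(\mathcal H)$ denotes the operators on $\mathcal H$, $\|\cdot\|_1$ is the trace norm, and maps are tacitly tensored with the identity on registers they do not act on. A symmetric-key quantum encryption scheme is a triple $(\tau_K,E,D)$ consisting of a classical (diagonal) density operator $\tau_K$ on $\mathcal H_K$ and channels (completely positive trace-preserving, CPTP, maps) $$E:\mathcal B(\mathcal H_A\otimes\mathcal H_K)\to\mathcal B(\mathcal H_C\otimes\mathcal H_K),\qquad D:\mathcal B(\mathcal H_C\otimes\mathcal H_K)\to\mathcal B((\mathcal H_A\oplus\mathbb C|\bot\rangle)\otimes\mathcal H_K)$$ such that $D(E(X\otimes|k\rangle\langle k|))=(X\oplus 0_\bot)\otimes|k\rangle\langle k|$ for all $X\in\mathcal B(\mathcal H_A)$ and all $k$. Assume $\mathcal H_A\neq 0$. Let $\Pi_{\mathsf{acc}}$ be the projection onto $\mathcal H_A$ in $\mathcal H_A\oplus\mathbb C|\bot\rangle$, and let $M_\bot(X)=\Pi_{\mathsf{acc}}X\Pi_{\mathsf{acc}}+|\bot\rangle\langle\bot|X|\bot\rangle\langle\bot|$ be the channel that measures the rejection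 symbol versus the rest. The scheme is $\varepsilon$-GYZ-authenticating ($\varepsilon$-totally authenticating) if for all registers $B,B'$ and every CPTP map $\Lambda_{CB\to CB'}$ there is a completely positive (CP) map $\Lambda^{\mathsf{acc}}_{B\to B'}$ such that for all states $\rho_{AB}$ $$\bigl\|\Pi_{\mathsf{acc}}\,D(\Lambda(E(\rho_{AB}\otimes\tau_K)))\,\Pi_{\mathsf{acc}}-\Lambda^{\mathsf{acc}}(\rho_{AB})\otimes\tau_K\bigr\|_1\le\varepsilon .$$ It is $\delta$-DNS-authenticating if for all registers $B,B'$ and every CPTP map $\Lambda_{CB\to CB'}$ there are CP maps $\Lambda^{\mathsf{acc}}_{B\to B'}$ and $\Lambda^{\mathsf{rej}}_{B\to B'}$ such that $\Lambda^{\mathsf{acc}}+\Lambda^{\mathsf{rej}}$ is trace preserving and for all states $\rho_{AB}$ $$\bigl\|\mathrm{Tr}_K D(\Lambda(E(\rho_{AB}\otimes\tau_K)))-\bigl(\Lambda^{\mathsf{acc}}(\rho_{AB})+|\bot\rangle\langle\bot|\otimes\Lambda^{\mathsf{rej}}(\rho_B)\bigr)\bigr\|_1\le\delta .$$ **Theorem.**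 Let $(\tau_K,E,D)$ be $\varepsilon$-GYZ-authenticating with $\varepsilon\le 62^{-2}$. Then the scheme $(\tau_K,E,M_\bot\circ D)$, whose decryption measures the rejection symbol, is $4(28\sqrt\varepsilon+3\varepsilon)$-DNS-authenticating. In particular, if $D=M_\bot\circ D$, then $(\tau_K,E,D)$ itself is $4(28\sqrt\varepsilon+3\varepsilon)$-DNS-authenticating, hence $O(\sqrt\varepsilon)$-DNS-authenticating. -/

import Mathlib

open Matrix
open scoped ComplexOrder Kronecker

/-! A finite type `X` indexes the standard basis of the Hilbert space `ℂ^X` of a register; operators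
on it are matrices `Matrix X X ℂ`, and the joint register of `X` and `Y` is indexed by `X × Y`. -/

/-- The trace norm (Schatten 1-norm): the sum of the singular values. -/
noncomputable def traceNorm {n : Type} [Fintype n] [DecidableEq n] (X : Matrix n n ℂ) : ℝ :=
  ∑ i, √((Matrix.posSemidef_conjTranspose_mul_self X).isHermitian.eigenvalues i)

/-- Density operators. -/
def IsState {n : Type} [Fintype n] (ρ : Matrix n n ℂ) : Prop :=
  ρ.PosSemidef ∧ ρ.trace = 1

/-- `Φ ⊗ id_R`: a map of operators applied to the first register. -/
def onFst {m n : Type} (R : Type) (Φ : Matrix m m ℂ →ₗ[ℂ] Matrix n n ℂ)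
    (X : Matrix (m × R) (m × R) ℂ) : Matrix (n × R) (n × R) ℂ :=
  Matrix.of fun p q => Φ (Matrix.of fun i j => X (i, p.2) (j, q.2)) p.1 q.1

/-- `id_R ⊗ Φ`: a map of operators applied to the second register. -/
def onSnd {m n : Type} (R : Type) (Φ : Matrix m m ℂ →ₗ[ℂ] Matrix n n ℂ)
    (X : Matrix (R × m) (R × m) ℂ) : Matrix (R × n) (R × n) ℂ :=
  Matrix.of fun p q => Φ (Matrix.of fun i j => X (p.1, i) (q.1, j)) p.2 q.2

/-- Completely positive maps. -/
def IsCP {m n : Type} (Φ : Matrix m m ℂ →ₗ[ℂ] Matrix n n ℂ) : Prop :=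
  ∀ (k : ℕ) (X : Matrix (m × Fin k) (m × Fin k) ℂ), X.PosSemidef → (onFst (Fin k) Φ X).PosSemidef

/-- Trace-preserving maps. -/
def IsTP {m n : Type} [Fintype m] [Fintype n] (Φ : Matrix m m ℂ →ₗ[ℂ] Matrix n n ℂ) : Prop :=
  ∀ X, (Φ X).trace = X.trace

/-- Quantum channels: completely positive trace-preserving maps. -/
def IsCPTP {m n : Type} [Fintype m] [Fintype n] (Φ : Matrix m m ℂ →ₗ[ℂ] Matrix n n ℂ) : Prop :=
  IsCP Φ ∧ IsTP Φ

/-- The partial trace over the first register. -/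
def ptraceFst {X Y : Type} [Fintype X] (M : Matrix (X × Y) (X × Y) ℂ) : Matrix Y Y ℂ :=
  Matrix.of fun i j => ∑ x, M (x, i) (x, j)

/-- The partial trace over the second register. -/
def ptraceSnd {X Y : Type} [Fintype Y] (M : Matrix (X × Y) (X × Y) ℂ) : Matrix X X ℂ :=
  Matrix.of fun i j => ∑ y, M (i, y) (j, y)

/-- Reordering of registers from `X Y Z` to `X Z Y`. -/
def swapReg {X Y Z : Type} (M : Matrix ((X × Y) × Z) ((X × Y) × Z) ℂ) :
    Matrix ((X × Z) × Y) ((X × Z) × Y) ℂ :=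
  M.submatrix (fun p => ((p.1.1, p.2), p.1.2)) (fun p => ((p.1.1, p.2), p.1.2))

/-- The inclusion `X ↦ X ⊕ 0_⊥` of the operators on `H_A ⊗ H_R` into those on
`(H_A ⊕ ℂ|⊥⟩) ⊗ H_R`. The space `H_A ⊕ ℂ|⊥⟩` is indexed by `Option A`, with `none` for `⊥`. -/
def embedAcc {A R : Type} (X : Matrix (A × R) (A × R) ℂ) :
    Matrix (Option A × R) (Option A × R) ℂ :=
  Matrix.of fun p q =>
    match p.1, q.1 with
    | some a, some a' => X (a, p.2) (a', q.2)
    | _, _ => 0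

/-- The acceptance projector: the projection onto `H_A` in `H_A ⊕ ℂ|⊥⟩`. -/
def accProj (A : Type) [DecidableEq A] : Matrix (Option A) (Option A) ℂ :=
  Matrix.diagonal fun x => if x.isSome then 1 else 0

/-- The rejection projector `|⊥⟩⟨⊥|`. -/
def rejProj (A : Type) [DecidableEq A] : Matrix (Option A) (Option A) ℂ :=
  Matrix.single none none 1

/-- The measurement channel `M_⊥` on `(H_A ⊕ ℂ|⊥⟩) ⊗ H_K` that measures the rejection symbol
versus the rest. -/
def measureBot (A K : Type) [Fintype A] [DecidableEq A] [Fintype K] [DecidableEq K] :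
    Matrix (Option A × K) (Option A × K) ℂ →ₗ[ℂ] Matrix (Option A × K) (Option A × K) ℂ where
  toFun X := (accProj A ⊗ₖ 1) * X * (accProj A ⊗ₖ 1) + (rejProj A ⊗ₖ 1) * X * (rejProj A ⊗ₖ 1)
  map_add' X Y := by simp only [Matrix.mul_add, Matrix.add_mul]; abel
  map_smul' c X := by simp

theorem measureBot_apply {A K : Type} [Fintype A] [DecidableEq A] [Fintype K] [DecidableEq K]
    (X : Matrix (Option A × K) (Option A × K) ℂ) (p q : Option A × K) :
    measureBot A K X p q = if p.1.isSome = q.1.isSome then X p q else 0 := by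
  have h1 : (accProj A ⊗ₖ (1 : Matrix K K ℂ)) =
      Matrix.diagonal fun p : Option A × K => if p.1.isSome then 1 else 0 := by
    rw [accProj, ← Matrix.diagonal_one, Matrix.diagonal_kronecker_diagonal]
    simp
  have h2 : (rejProj A ⊗ₖ (1 : Matrix K K ℂ)) =
      Matrix.diagonal fun p : Option A × K => if p.1.isSome then 0 else 1 := by
    have : rejProj A = Matrix.diagonal fun x : Option A => if x.isSome then 0 else 1 := by
      ext i j
      cases i <;> cases j <;> simp [rejProj, Matrix.single, Matrix.diagonal_apply]
    rw [this, ← Matrix.diagonal_one, Matrix.diagonal_kronecker_diagonal]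
    simp
  change ((accProj A ⊗ₖ 1) * X * (accProj A ⊗ₖ 1) +
    (rejProj A ⊗ₖ 1) * X * (rejProj A ⊗ₖ 1) : Matrix _ _ ℂ) p q = _
  rw [h1, h2, Matrix.add_apply, Matrix.mul_diagonal, Matrix.mul_diagonal, Matrix.diagonal_mul,
    Matrix.diagonal_mul]
  rcases p with ⟨_ | a, k⟩ <;> rcases q with ⟨_ | b, l⟩ <;> simp

theorem measureBot_isCPTP (A K : Type) [Fintype A] [DecidableEq A] [Fintype K] [DecidableEq K] :
    IsCPTP (measureBot A K) := by
  refine ⟨fun k X hX => ?_, fun X => ?_⟩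
  · let P (b : Bool) : Matrix ((Option A × K) × Fin k) ((Option A × K) × Fin k) ℂ :=
      Matrix.diagonal fun p => if p.1.1.isSome = b then 1 else 0
    have hP : ∀ b, (P b)ᴴ = P b := fun b => by
      ext i j
      simp only [P, Matrix.conjTranspose_apply, Matrix.diagonal_apply]
      by_cases h : i = j
      · subst h; simp
      · simp [h, Ne.symm h]
    have h : onFst (Fin k) (measureBot A K) X =
        P true * X * (P true)ᴴ + P false * X * (P false)ᴴ := by
      rw [hP, hP]
      ext ⟨⟨a, c⟩, i⟩ ⟨⟨b, d⟩, j⟩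
      simp only [onFst, Matrix.of_apply, measureBot_apply, P, Matrix.add_apply,
        Matrix.mul_diagonal, Matrix.diagonal_mul]
      cases a <;> cases b <;> simp
    rw [h]
    exact (hX.mul_mul_conjTranspose_same _).add (hX.mul_mul_conjTranspose_same _)
  · simp [Matrix.trace, measureBot_apply]

theorem IsCPTP.comp {l m n : Type} [Fintype l] [Fintype m] [Fintype n]
    {Ψ : Matrix m m ℂ →ₗ[ℂ] Matrix n n ℂ} {Φ : Matrix l l ℂ →ₗ[ℂ] Matrix m m ℂ}
    (hΨ : IsCPTP Ψ) (hΦ : IsCPTP Φ) : IsCPTP (Ψ ∘ₗ Φ) :=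
  ⟨fun k X hX => hΨ.1 k _ (hΦ.1 k X hX), fun X => (hΨ.2 _).trans (hΦ.2 X)⟩

theorem measureBot_embedAcc {A K : Type} [Fintype A] [DecidableEq A] [Fintype K] [DecidableEq K]
    (X : Matrix (A × K) (A × K) ℂ) : measureBot A K (embedAcc X) = embedAcc X := by
  ext ⟨a, k⟩ ⟨b, l⟩
  rw [measureBot_apply]
  cases a <;> cases b <;> simp [embedAcc]

/-- A symmetric-key quantum encryption scheme with plaintext register `A`, key register `K` and
ciphertext register `C`: a classical (diagonal) key state and channels
`E : B(H_A ⊗ H_K) → B(H_C ⊗ H_K)` and `D : B(H_C ⊗ H_K) → B((H_A ⊕ ℂ|⊥⟩) ⊗ H_K)` with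
`D (E (X ⊗ |k⟩⟨k|)) = (X ⊕ 0_⊥) ⊗ |k⟩⟨k|` for every key `k`. -/
structure QES (A K C : Type) [Fintype A] [DecidableEq A] [Fintype K] [DecidableEq K]
    [Fintype C] [DecidableEq C] where
  key : Matrix K K ℂ
  enc : Matrix (A × K) (A × K) ℂ →ₗ[ℂ] Matrix (C × K) (C × K) ℂ
  dec : Matrix (C × K) (C × K) ℂ →ₗ[ℂ] Matrix (Option A × K) (Option A × K) ℂ
  key_isState : IsState key
  key_classical : key.IsDiag
  enc_isCPTP : IsCPTP enc
  dec_isCPTP : IsCPTP dec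
  correct : ∀ (k : K) (X : Matrix A A ℂ),
    dec (enc (X ⊗ₖ Matrix.single k k 1)) = embedAcc (X ⊗ₖ Matrix.single k k 1)

namespace QES

variable {A K C : Type} [Fintype A] [DecidableEq A] [Fintype K] [DecidableEq K]
  [Fintype C] [DecidableEq C]

/-- The operator `D(Λ(E(ρ_AB ⊗ τ_K)))` on the registers `(A ⊕ ⊥) B' K`, for an attack `Λ` that maps
`C B` to `C B'`. -/
def run (S : QES A K C) {B B' : Type} (Λ : Matrix (C × B) (C × B) ℂ →ₗ[ℂ] Matrix (C × B') (C × B') ℂ)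
    (ρ : Matrix (A × B) (A × B) ℂ) :
    Matrix ((Option A × B') × K) ((Option A × B') × K) ℂ :=
  swapReg (onFst B' S.dec (swapReg (onFst K Λ (swapReg (onFst B S.enc (swapReg (ρ ⊗ₖ S.key)))))))

/-- `ε`-GYZ-authentication (total authentication): for every attack there is a completely positive
`Λacc` with `‖Π_acc D(Λ(E(ρ_AB ⊗ τ_K))) Π_acc - Λacc(ρ_AB) ⊗ τ_K‖₁ ≤ ε` for all states `ρ_AB`. -/
def IsGYZAuthenticating (S : QES A K C) (ε : ℝ) : Prop :=
  ∀ (B B' : Type) [Fintype B] [DecidableEq B] [Fintype B'] [DecidableEq B']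
    (Λ : Matrix (C × B) (C × B) ℂ →ₗ[ℂ] Matrix (C × B') (C × B') ℂ), IsCPTP Λ →
    ∃ Λacc : Matrix B B ℂ →ₗ[ℂ] Matrix B' B' ℂ, IsCP Λacc ∧
      ∀ ρ : Matrix (A × B) (A × B) ℂ, IsState ρ →
        traceNorm (((accProj A ⊗ₖ (1 : Matrix B' B' ℂ)) ⊗ₖ (1 : Matrix K K ℂ)) * S.run Λ ρ *
              ((accProj A ⊗ₖ (1 : Matrix B' B' ℂ)) ⊗ₖ (1 : Matrix K K ℂ)) -
            embedAcc (onSnd A Λacc ρ) ⊗ₖ S.key) ≤ ε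

/-- `δ`-DNS-authentication: for every attack there are completely positive `Λacc`, `Λrej` with
trace-preserving sum such that, for all states `ρ_AB`,
`‖Tr_K D(Λ(E(ρ_AB ⊗ τ_K))) - (Λacc(ρ_AB) + |⊥⟩⟨⊥| ⊗ Λrej(ρ_B))‖₁ ≤ δ`. -/
def IsDNSAuthenticating (S : QES A K C) (δ : ℝ) : Prop :=
  ∀ (B B' : Type) [Fintype B] [DecidableEq B] [Fintype B'] [DecidableEq B']
    (Λ : Matrix (C × B) (C × B) ℂ →ₗ[ℂ] Matrix (C × B') (C × B') ℂ), IsCPTP Λ →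
    ∃ Λacc Λrej : Matrix B B ℂ →ₗ[ℂ] Matrix B' B' ℂ,
      IsCP Λacc ∧ IsCP Λrej ∧ IsTP (Λacc + Λrej) ∧
      ∀ ρ : Matrix (A × B) (A × B) ℂ, IsState ρ →
        traceNorm (ptraceSnd (S.run Λ ρ) -
            (embedAcc (onSnd A Λacc ρ) + rejProj A ⊗ₖ Λrej (ptraceFst ρ))) ≤ δ

/-- The decryption satisfies `D = M_⊥ ∘ D`: its output has no coherence between the rejection symbol
and the plaintext space. -/
def MeasuresRejection (S : QES A K C) : Prop :=
  measureBot A K ∘ₗ S.dec = S.dec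

/-- The scheme `(τ, E, M_⊥ ∘ D)`. -/
def withMeasuredRejection (S : QES A K C) : QES A K C where
  key := S.key
  enc := S.enc
  dec := measureBot A K ∘ₗ S.dec
  key_isState := S.key_isState
  key_classical := S.key_classical
  enc_isCPTP := S.enc_isCPTP
  dec_isCPTP := (measureBot_isCPTP A K).comp S.dec_isCPTP
  correct k X := by
    rw [LinearMap.comp_apply, S.correct, measureBot_embedAcc]

end QES

/-! Accepted outputs are already simulated by the GYZ condition, so the point is that the state left
after rejection hardly depends on the plaintext. The rejected marginal on `B'` is the attacked
ciphertext without key, minus the accepted marginal (`rejected_eq`). The accepted marginal is within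
`ε` of `Λacc(ρ_B)`, so it remains to show that the scheme encrypts: the ciphertext `Tr_K E(ρ_AB ⊗
τ_K)` depends on `ρ_B` only, up to `2ε`.

To see this, let `U` be a Hermitian unitary on `C B` and let the adversary apply it controlled by a
qubit in `|+⟩`, keeping the qubit. The off-diagonal blocks of the qubit contain `U E(ρ)` and `E(ρ)
U`. An honest ciphertext is never rejected, and a positive functional that vanishes on a positive
operator vanishes on all its multiples (`Matrix.PosSemidef.map_mul_eq_zero`), so these blocks are
accepted with their full trace. Hence `σ_x` on the qubit of the accepted part has expectation `Tr(U
· ciphertext)`, which by the GYZ condition is within `ε` of a number determined by `ρ_B`. Varying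
`U` gives the trace norm bound.

The rejection simulator runs the attack on a fixed plaintext. Rescaling both simulators and putting
the missing trace on a fixed state makes the sum trace preserving. The total error is `9ε`, below
the claimed bound. -/

/-! ### Trace norm of Hermitian matrices, and positive functionals. -/

section TraceNorm

variable {n m : Type} [Fintype n] [DecidableEq n] [Fintype m]

/-- `X` is a difference of positive semidefinite matrices whose traces add up to at most `c`. For
Hermitian `X` this says that the trace norm of `X` is at most `c`. -/
def HasTraceNormLE {n : Type} [Fintype n] (X : Matrix n n ℂ) (c : ℝ) : Prop :=
  ∃ P N : Matrix n n ℂ, P.PosSemidef ∧ N.PosSemidef ∧ X = P - N ∧ P.trace.re + N.trace.re ≤ c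

theorem Matrix.PosSemidef.trace_re_nonneg {P : Matrix m m ℂ} (hP : P.PosSemidef) :
    0 ≤ P.trace.re :=
  (Complex.nonneg_iff.1 hP.trace_nonneg).1

theorem Matrix.PosSemidef.trace_eq_ofReal {P : Matrix m m ℂ} (hP : P.PosSemidef) :
    P.trace = (P.trace.re : ℂ) :=
  Complex.ext rfl (by simpa using (Complex.nonneg_iff.1 hP.trace_nonneg).2.symm)

namespace HasTraceNormLE

variable {X Y : Matrix m m ℂ} {c d : ℝ}

theorem mono (h : HasTraceNormLE X c) (hcd : c ≤ d) : HasTraceNormLE X d := by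
  obtain ⟨P, N, hP, hN, hX, hc⟩ := h
  exact ⟨P, N, hP, hN, hX, hc.trans hcd⟩

theorem add (hX : HasTraceNormLE X c) (hY : HasTraceNormLE Y d) :
    HasTraceNormLE (X + Y) (c + d) := by
  obtain ⟨P, N, hP, hN, rfl, hc⟩ := hX
  obtain ⟨P', N', hP', hN', rfl, hd⟩ := hY
  refine ⟨P + P', N + N', hP.add hP', hN.add hN', by abel, ?_⟩
  simp only [trace_add, Complex.add_re]
  linarith

theorem neg (hX : HasTraceNormLE X c) : HasTraceNormLE (-X) c := by
  obtain ⟨P, N, hP, hN, rfl, hc⟩ := hX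
  exact ⟨N, P, hN, hP, by abel, by linarith⟩

theorem sub (hX : HasTraceNormLE X c) (hY : HasTraceNormLE Y d) :
    HasTraceNormLE (X - Y) (c + d) :=
  sub_eq_add_neg X Y ▸ hX.add hY.neg

theorem of_posSemidef (hX : X.PosSemidef) (h : X.trace.re ≤ c) : HasTraceNormLE X c :=
  ⟨X, 0, hX, PosSemidef.zero, by simp, by simpa using h⟩

/-- Positive maps that do not increase the trace do not increase the trace norm. -/
theorem map {k : Type} [Fintype k] (hX : HasTraceNormLE X c)
    (f : Matrix m m ℂ →ₗ[ℂ] Matrix k k ℂ) (hpos : ∀ P, P.PosSemidef → (f P).PosSemidef)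
    (htr : ∀ P, P.PosSemidef → (f P).trace.re ≤ P.trace.re) : HasTraceNormLE (f X) c := by
  obtain ⟨P, N, hP, hN, rfl, hc⟩ := hX
  exact ⟨f P, f N, hpos P hP, hpos N hN, map_sub f P N,
    (add_le_add (htr P hP) (htr N hN)).trans hc⟩

end HasTraceNormLE

/-- A Hermitian unitary is a contraction. -/
theorem abs_trace_mul_re_le_of_posSemidef {U P : Matrix n n ℂ} (hU : U.IsHermitian)
    (hUU : U * U = 1) (hP : P.PosSemidef) : |(U * P).trace.re| ≤ P.trace.re := by
  have key : ∀ V : Matrix n n ℂ, V.IsHermitian → V * V = 1 → -(V * P).trace.re ≤ P.trace.re := by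
    intro V hV hVV
    -- Since `(1 + V)² = 2(1 + V)`, the nonnegative trace of `(1 + V) P (1 + V)` is `2 Tr((1 + V)
    -- P)`.
    have h := (hP.mul_mul_conjTranspose_same (1 + V)).trace_re_nonneg
    rw [conjTranspose_add, conjTranspose_one, hV.eq, trace_mul_comm, ← Matrix.mul_assoc,
      show (1 + V) * (1 + V) = (2 : ℂ) • (1 + V) by
        rw [Matrix.add_mul, Matrix.mul_add V, hVV, two_smul, Matrix.one_mul, Matrix.mul_one]; abel,
      Matrix.smul_mul, trace_smul, Matrix.add_mul, Matrix.one_mul, trace_add] at h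
    simp at h
    linarith
  rw [abs_le]
  constructor
  · linarith [key U hU hUU]
  · have := key (-U) hU.neg (by simpa using hUU)
    simpa using this

theorem HasTraceNormLE.abs_trace_mul_re_le {U X : Matrix n n ℂ} {c : ℝ} (hX : HasTraceNormLE X c)
    (hU : U.IsHermitian) (hUU : U * U = 1) : |(U * X).trace.re| ≤ c := by
  obtain ⟨P, N, hP, hN, rfl, hc⟩ := hX
  have h1 := abs_trace_mul_re_le_of_posSemidef hU hUU hP
  have h2 := abs_trace_mul_re_le_of_posSemidef hU hUU hN
  rw [Matrix.mul_sub, trace_sub, Complex.sub_re]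
  exact (abs_sub _ _).trans ((add_le_add h1 h2).trans hc)

/-- The Jordan decomposition of a Hermitian matrix, together with its sign. -/
theorem Matrix.IsHermitian.exists_jordan {X : Matrix n n ℂ} (hX : X.IsHermitian) :
    ∃ U P N : Matrix n n ℂ, U.IsHermitian ∧ U * U = 1 ∧ P.PosSemidef ∧ N.PosSemidef ∧ X = P - N ∧
      U * X = P + N ∧ traceNorm X = P.trace.re + N.trace.re := by
  set V : Matrix n n ℂ := (hX.eigenvectorUnitary : Matrix n n ℂ)
  have hVV : Vᴴ * V = 1 := Unitary.coe_star_mul_self hX.eigenvectorUnitary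
  have hVV' : V * Vᴴ = 1 := Unitary.coe_mul_star_self hX.eigenvectorUnitary
  set l := hX.eigenvalues
  -- Functional calculus in a fixed eigenbasis of `X`: every identity below reduces to one between
  -- real functions of the index.
  let F (f : n → ℝ) : Matrix n n ℂ := V * diagonal (fun i => (f i : ℂ)) * Vᴴ
  have hmul : ∀ f g, F f * F g = F (f * g) := fun f g => by
    calc F f * F g = V * diagonal (fun i => (f i : ℂ)) * (Vᴴ * V) *
          (diagonal (fun i => (g i : ℂ)) * Vᴴ) := by simp only [F, Matrix.mul_assoc]
      _ = V * (diagonal (fun i => (f i : ℂ)) * diagonal (fun i => (g i : ℂ))) * Vᴴ := by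
          rw [hVV]; simp only [Matrix.mul_assoc, Matrix.one_mul]
      _ = _ := by rw [diagonal_mul_diagonal]; simp [F]
  have hadd : ∀ f g, F f + F g = F (f + g) := fun f g => by
    simp only [F, ← Matrix.add_mul, ← Matrix.mul_add, diagonal_add, Pi.add_apply, Complex.ofReal_add]
  have hsub : ∀ f g, F f - F g = F (f - g) := fun f g => by
    simp only [F, ← Matrix.sub_mul, ← Matrix.mul_sub, diagonal_sub, Pi.sub_apply, Complex.ofReal_sub]
  have hherm : ∀ f, (F f)ᴴ = F f := fun f => by
    simp only [F, conjTranspose_mul, conjTranspose_conjTranspose, diagonal_conjTranspose,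
      Matrix.mul_assoc]
    congr 3
    ext i
    simp
  have hpos : ∀ f : n → ℝ, (∀ i, 0 ≤ f i) → (F f).PosSemidef := fun f hf =>
    (PosSemidef.diagonal fun i => by simpa using hf i).mul_mul_conjTranspose_same V
  have htr : ∀ f, (F f).trace = ((∑ i, f i : ℝ) : ℂ) := fun f => by
    rw [trace_mul_comm, ← Matrix.mul_assoc, hVV, Matrix.one_mul, trace_diagonal, Complex.ofReal_sum]
  have hXF : X = F l := by
    conv_lhs => rw [hX.spectral_theorem, Unitary.conjStarAlgAut_apply]
    rfl
  have hnorm : traceNorm X = ∑ i, |l i| := by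
    -- The eigenvalues in `traceNorm` come from a separate diagonalization of `Xᴴ * X`; equality of
    -- the root multisets of the characteristic polynomial matches them with the squares of `l`.
    have hchar : (Xᴴ * X).charpoly =
        ∏ i, (Polynomial.X - Polynomial.C (((l * l) i : ℝ) : ℂ)) := by
      rw [hXF, hherm, hmul, charpoly_mul_comm, ← Matrix.mul_assoc, hVV, Matrix.one_mul,
        charpoly_diagonal]
    have hroots := (posSemidef_conjTranspose_mul_self X).isHermitian.roots_charpoly_eq_eigenvalues
    have hmap : Finset.univ.val.map (fun i => Polynomial.X - Polynomial.C (((l * l) i : ℝ) : ℂ)) =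
        (Finset.univ.val.map fun i => (((l * l) i : ℝ) : ℂ)).map
          fun z => Polynomial.X - Polynomial.C z := by
      rw [Multiset.map_map]; rfl
    rw [hchar, Finset.prod_eq_multiset_prod, hmap, Polynomial.roots_multiset_prod_X_sub_C] at hroots
    have := congr_arg (fun s => (s.map fun z : ℂ => √z.re).sum) hroots
    simpa [traceNorm, Multiset.map_map, Real.sqrt_mul_self_eq_abs] using this.symm
  -- The sign takes the value `1` at eigenvalue `0`, so that it squares to the identity.
  refine ⟨F fun i => if 0 ≤ l i then 1 else -1, F fun i => max (l i) 0, F fun i => max (-l i) 0,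
    hherm _, ?_, hpos _ fun i => le_max_right _ _, hpos _ fun i => le_max_right _ _, ?_, ?_, ?_⟩
  · rw [hmul, ← hVV']
    have : ((fun i => if 0 ≤ l i then 1 else -1) * fun i => if 0 ≤ l i then (1 : ℝ) else -1) = 1 := by
      ext i; by_cases h : 0 ≤ l i <;> simp [h]
    rw [this]
    simp [F]
  · rw [hsub, hXF]
    congr 1
    ext i
    rcases le_total 0 (l i) with h | h <;> simp [h]
  · rw [hXF, hmul, hadd]
    congr 1
    ext i
    rcases le_total 0 (l i) with h | h
    · simp [h]
    · rcases h.eq_or_lt with h | h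
      · simp [h]
      · simp [h.le, h.not_ge]
  · rw [hnorm, htr, htr, Complex.ofReal_re, Complex.ofReal_re, ← Finset.sum_add_distrib]
    refine Finset.sum_congr rfl fun i _ => ?_
    rcases le_total 0 (l i) with h | h <;> simp [h, abs_of_nonneg, abs_of_nonpos]

/-- Pairing with the sign of `X` gives exactly the trace norm, and by contractivity no decomposition
into positive parts can cost less; the Jordan decomposition attains it. -/
theorem hasTraceNormLE_iff {X : Matrix n n ℂ} (hX : X.IsHermitian) {c : ℝ} :
    HasTraceNormLE X c ↔ traceNorm X ≤ c := by
  obtain ⟨U, P, N, hU, hUU, hP, hN, hXPN, hUX, hn⟩ := hX.exists_jordan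
  refine ⟨fun h => ?_, fun h => ⟨P, N, hP, hN, hXPN, hn ▸ h⟩⟩
  have := (abs_le.1 (h.abs_trace_mul_re_le hU hUU)).2
  rwa [hUX, trace_add, Complex.add_re, ← hn] at this

/-- The trace norm of a Hermitian matrix is attained on a Hermitian unitary. -/
theorem hasTraceNormLE_of_forall_trace_mul {X : Matrix n n ℂ} (hX : X.IsHermitian) {c : ℝ}
    (h : ∀ U : Matrix n n ℂ, U.IsHermitian → U * U = 1 → (U * X).trace.re ≤ c) :
    HasTraceNormLE X c := by
  obtain ⟨U, P, N, hU, hUU, hP, hN, hXPN, hUX, -⟩ := hX.exists_jordan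
  refine ⟨P, N, hP, hN, hXPN, ?_⟩
  simpa [hUX] using h U hU hUU

theorem HasTraceNormLE.isHermitian {X : Matrix m m ℂ} {c : ℝ} (h : HasTraceNormLE X c) :
    X.IsHermitian := by
  obtain ⟨P, N, hP, hN, rfl, -⟩ := h
  exact hP.isHermitian.sub hN.isHermitian

/-- With `G = aᴴa` and `S = bᴴb` the trace is the squared Hilbert–Schmidt norm of `abᴴ`, which is a
factor of `GS`. -/
theorem Matrix.PosSemidef.mul_eq_zero_of_trace_mul_eq_zero {G S : Matrix n n ℂ}
    (hG : G.PosSemidef) (hS : S.PosSemidef) (h : (G * S).trace = 0) : G * S = 0 := by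
  open scoped MatrixOrder Matrix.Norms.L2Operator in
  obtain ⟨a, rfl⟩ := CStarAlgebra.nonneg_iff_eq_star_mul_self.mp hG.nonneg
  open scoped MatrixOrder Matrix.Norms.L2Operator in
  obtain ⟨b, rfl⟩ := CStarAlgebra.nonneg_iff_eq_star_mul_self.mp hS.nonneg
  simp only [star_eq_conjTranspose] at h ⊢
  have h' : ((a * bᴴ)ᴴ * (a * bᴴ)).trace = 0 := by
    rw [← h, ← Matrix.mul_assoc (aᴴ * a), trace_mul_comm _ b]
    simp only [conjTranspose_mul, conjTranspose_conjTranspose, Matrix.mul_assoc]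
  rw [trace_conjTranspose_mul_self_eq_zero_iff] at h'
  rw [Matrix.mul_assoc, ← Matrix.mul_assoc a, h', Matrix.zero_mul, Matrix.mul_zero]

/-- In the order of `ℂ`, being nonnegative includes being real, so the quadratic form alone forces
`M` to be Hermitian. -/
theorem Matrix.posSemidef_of_forall_dotProduct_mulVec_nonneg {M : Matrix n n ℂ}
    (h : ∀ x : n → ℂ, 0 ≤ star x ⬝ᵥ (M *ᵥ x)) : M.PosSemidef := by
  rw [← isPositive_toEuclideanLin_iff, LinearMap.isPositive_iff_complex]
  intro x
  have hx : inner ℂ (M.toEuclideanLin x) x = star (star x.ofLp ⬝ᵥ (M *ᵥ x.ofLp)) := by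
    rw [EuclideanSpace.inner_eq_star_dotProduct, dotProduct_comm,
      ← star_dotProduct]
    rfl
  have h1 := Complex.nonneg_iff.1 (h x.ofLp)
  rw [hx]
  refine ⟨Complex.ext ?_ ?_, ?_⟩
  · simp
  · simp [← h1.2]
  · simpa using h1.1

/-- If a positive functional vanishes on a positive semidefinite matrix `S`, then it vanishes on all
multiples of `S`. -/
theorem Matrix.PosSemidef.map_mul_eq_zero {S : Matrix n n ℂ} (hS : S.PosSemidef)
    (h : Matrix n n ℂ →ₗ[ℂ] ℂ) (hpos : ∀ P, P.PosSemidef → 0 ≤ h P) (h0 : h S = 0)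
    (M : Matrix n n ℂ) : h (M * S) = 0 ∧ h (S * M) = 0 := by
  -- The matrix representing the functional, `h Y = Tr(G Y)`; positivity of `h` on rank-one
  -- projections makes it positive semidefinite.
  let G : Matrix n n ℂ := of fun i j => h (single j i 1)
  have hG : ∀ Y, h Y = (G * Y).trace := fun Y => by
    conv_lhs => rw [matrix_eq_sum_single Y]
    simp only [map_sum, trace, diag, mul_apply, G, of_apply]
    rw [Finset.sum_comm]
    refine Finset.sum_congr rfl fun i _ => Finset.sum_congr rfl fun j _ => ?_
    rw [← mul_one (Y j i), ← smul_eq_mul, ← smul_single, map_smul, smul_eq_mul, smul_eq_mul]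
    ring
  have hGpos : G.PosSemidef := by
    refine posSemidef_of_forall_dotProduct_mulVec_nonneg fun x => ?_
    rw [dotProduct_comm, ← trace_vecMulVec, ← mul_vecMulVec, ← hG]
    exact hpos _ (posSemidef_vecMulVec_self_star x)
  have hGS := hGpos.mul_eq_zero_of_trace_mul_eq_zero hS (by rw [← hG, h0])
  have hSG : S * G = 0 := by
    simpa [hGpos.isHermitian.eq, hS.isHermitian.eq] using congr_arg (fun M => Mᴴ) hGS
  constructor
  · rw [hG, trace_mul_comm, Matrix.mul_assoc, hSG, Matrix.mul_zero, trace_zero]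
  · rw [hG, ← Matrix.mul_assoc, hGS, Matrix.zero_mul, trace_zero]

end TraceNorm

/-! ### Completely positive maps and partial traces. -/

section CompletelyPositive

variable {l m n : Type}

/-- The compression `X ↦ X.submatrix f f` as a linear map. -/
def submatrixLin (f : n → m) : Matrix m m ℂ →ₗ[ℂ] Matrix n n ℂ where
  toFun X := X.submatrix f f
  map_add' _ _ := rfl
  map_smul' _ _ := rfl

/-- `onFst R Φ` as a linear map. -/
def onFstLin (R : Type) (Φ : Matrix m m ℂ →ₗ[ℂ] Matrix n n ℂ) :
    Matrix (m × R) (m × R) ℂ →ₗ[ℂ] Matrix (n × R) (n × R) ℂ where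
  toFun := onFst R Φ
  map_add' X Y := by
    ext p q
    exact congr_fun₂ (map_add Φ (of fun i j => X (i, p.2) (j, q.2))
      (of fun i j => Y (i, p.2) (j, q.2))) p.1 q.1
  map_smul' c X := by
    ext p q
    exact congr_fun₂ (map_smul Φ c (of fun i j => X (i, p.2) (j, q.2))) p.1 q.1

/-- `X ↦ X ⊗ M` as a linear map. -/
def kroneckerRightLin (M : Matrix n n ℂ) : Matrix m m ℂ →ₗ[ℂ] Matrix (m × n) (m × n) ℂ where
  toFun X := X ⊗ₖ M
  map_add' X Y := add_kronecker X Y M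
  map_smul' c X := smul_kronecker c X M

/-- Conjugation `X ↦ V X Vᴴ` as a linear map. -/
def conjLin [Fintype m] (V : Matrix n m ℂ) : Matrix m m ℂ →ₗ[ℂ] Matrix n n ℂ where
  toFun X := V * X * Vᴴ
  map_add' X Y := by rw [Matrix.mul_add, Matrix.add_mul]
  map_smul' c X := by simp

/-- `IsCP` tests only ancillas `Fin k`; enumerating `R` transfers it to any finite register. -/
theorem onFst_posSemidef {R : Type} [Fintype R] {Φ : Matrix m m ℂ →ₗ[ℂ] Matrix n n ℂ} (hΦ : IsCP Φ)
    {X : Matrix (m × R) (m × R) ℂ} (hX : X.PosSemidef) : (onFst R Φ X).PosSemidef := by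
  let e := Fintype.equivFin R
  convert (hΦ _ _ (hX.submatrix fun p : m × Fin _ => (p.1, e.symm p.2))).submatrix
    fun p : n × R => (p.1, e p.2)
  ext p q
  simp [onFst]

namespace IsCP

theorem posSemidef {Φ : Matrix m m ℂ →ₗ[ℂ] Matrix n n ℂ} (hΦ : IsCP Φ) {X : Matrix m m ℂ}
    (hX : X.PosSemidef) : (Φ X).PosSemidef :=
  (onFst_posSemidef hΦ (hX.submatrix (Prod.fst : m × Unit → m))).submatrix fun i => (i, ())

theorem comp {Ψ : Matrix m m ℂ →ₗ[ℂ] Matrix n n ℂ} {Φ : Matrix l l ℂ →ₗ[ℂ] Matrix m m ℂ}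
    (hΨ : IsCP Ψ) (hΦ : IsCP Φ) : IsCP (Ψ ∘ₗ Φ) :=
  fun k X hX => hΨ k _ (hΦ k X hX)

theorem zero : IsCP (0 : Matrix m m ℂ →ₗ[ℂ] Matrix n n ℂ) :=
  fun _ _ _ => PosSemidef.zero

theorem add {Φ Ψ : Matrix m m ℂ →ₗ[ℂ] Matrix n n ℂ} (hΦ : IsCP Φ) (hΨ : IsCP Ψ) : IsCP (Φ + Ψ) :=
  fun k X hX => (hΦ k X hX).add (hΨ k X hX)

theorem smul {Φ : Matrix m m ℂ →ₗ[ℂ] Matrix n n ℂ} (hΦ : IsCP Φ) {c : ℂ} (hc : 0 ≤ c) :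
    IsCP (c • Φ) :=
  fun k X hX => (hΦ k X hX).smul hc

theorem sum {ι : Type} (s : Finset ι) {Φ : ι → Matrix m m ℂ →ₗ[ℂ] Matrix n n ℂ}
    (hΦ : ∀ i, IsCP (Φ i)) : IsCP (∑ i ∈ s, Φ i) := by
  classical
  induction s using Finset.induction_on with
  | empty => exact zero
  | insert i s hi ih => rw [Finset.sum_insert hi]; exact (hΦ i).add ih

theorem submatrixLin (f : n → m) : IsCP (submatrixLin f) :=
  fun k _ hX => hX.submatrix fun p : n × Fin k => (f p.1, p.2)

theorem onFstLin (R : Type) [Fintype R] {Φ : Matrix m m ℂ →ₗ[ℂ] Matrix n n ℂ} (hΦ : IsCP Φ) :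
    IsCP (onFstLin R Φ) :=
  fun k _ hX => (onFst_posSemidef (R := R × Fin k) hΦ
    (hX.submatrix fun p : m × (R × Fin k) => ((p.1, p.2.1), p.2.2))).submatrix
      fun p : (n × R) × Fin k => (p.1.1, (p.1.2, p.2))

theorem kroneckerRightLin [Finite m] [Finite n] {M : Matrix n n ℂ} (hM : M.PosSemidef) :
    IsCP (kroneckerRightLin (m := m) M) :=
  fun k _ hX => (hX.kronecker hM).submatrix fun p : (m × n) × Fin k => ((p.1.1, p.2), p.1.2)

theorem conjLin [Fintype m] [DecidableEq m] [Fintype n] (V : Matrix n m ℂ) : IsCP (conjLin V) := by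
  intro k X hX
  convert hX.mul_mul_conjTranspose_same (V ⊗ₖ (1 : Matrix (Fin k) (Fin k) ℂ))
  ext ⟨i, r⟩ ⟨j, s⟩
  simp [onFst, _root_.conjLin, mul_apply, Fintype.sum_prod_type, one_apply, Finset.sum_mul,
    apply_ite (starRingEnd ℂ)]

/-- A positive functional is completely positive. -/
theorem smulRight [Fintype m] [DecidableEq m] [Finite n] {t : Matrix m m ℂ →ₗ[ℂ] ℂ}
    (ht : ∀ X, X.PosSemidef → 0 ≤ t X) {M : Matrix n n ℂ} (hM : M.PosSemidef) :
    IsCP (t.smulRight M) := by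
  intro k X hX
  let T : Matrix (Fin k) (Fin k) ℂ := of fun r s => t (of fun i j => X (i, r) (j, s))
  have hT : T.PosSemidef := by
    refine posSemidef_of_forall_dotProduct_mulVec_nonneg fun v => ?_
    -- `W = 1 ⊗ |v⟩`, so compressing by `W` before applying `t` yields the quadratic form of `T` at
    -- `v`.
    let W : Matrix (m × Fin k) m ℂ := of fun p j => if p.1 = j then v p.2 else 0
    have hW : star v ⬝ᵥ (T *ᵥ v) = t (Wᴴ * X * W) := by
      have : Wᴴ * X * W = ∑ r, ∑ s, (star (v r) * v s) • of fun i j => X (i, r) (j, s) := by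
        ext i j
        simp only [Matrix.sum_apply, Matrix.smul_apply, of_apply, smul_eq_mul, mul_apply, W,
          Fintype.sum_prod_type, conjTranspose_apply]
        rw [Finset.sum_eq_single j (fun b _ hb => by simp [hb]) (by simp), Finset.sum_comm]
        refine Finset.sum_congr rfl fun s _ => ?_
        rw [Finset.sum_eq_single i (fun b _ hb => by simp [hb]) (by simp), if_pos rfl,
          Finset.sum_mul]
        refine Finset.sum_congr rfl fun r _ => ?_
        rw [if_pos rfl]
        ring
      rw [this]
      simp only [map_sum, map_smul, dotProduct, mulVec, T, of_apply, Finset.mul_sum, Pi.star_apply,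
        smul_eq_mul]
      refine Finset.sum_congr rfl fun r _ => Finset.sum_congr rfl fun s _ => by ring
    rw [hW]
    exact ht _ (hX.conjTranspose_mul_mul_same W)
  have : onFst (Fin k) (t.smulRight M) X = (T ⊗ₖ M).submatrix Prod.swap Prod.swap := by
    ext p q
    simp [onFst, T]
  exact this ▸ (hT.kronecker hM).submatrix Prod.swap

end IsCP

variable {X Y : Type}

/-- `ptraceFst` as a linear map. -/
def ptraceFstLin (X Y : Type) [Fintype X] : Matrix (X × Y) (X × Y) ℂ →ₗ[ℂ] Matrix Y Y ℂ :=
  ∑ x, submatrixLin fun y => (x, y)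

/-- `ptraceSnd` as a linear map. -/
def ptraceSndLin (X Y : Type) [Fintype Y] : Matrix (X × Y) (X × Y) ℂ →ₗ[ℂ] Matrix X X ℂ :=
  ∑ y, submatrixLin fun x => (x, y)

theorem ptraceFstLin_apply [Fintype X] (M : Matrix (X × Y) (X × Y) ℂ) :
    ptraceFstLin X Y M = ptraceFst M := by
  ext i j
  rw [ptraceFstLin, LinearMap.sum_apply, Matrix.sum_apply]
  rfl

theorem ptraceSndLin_apply [Fintype Y] (M : Matrix (X × Y) (X × Y) ℂ) :
    ptraceSndLin X Y M = ptraceSnd M := by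
  ext i j
  rw [ptraceSndLin, LinearMap.sum_apply, Matrix.sum_apply]
  rfl

theorem Matrix.PosSemidef.ptraceFst [Fintype X] {M : Matrix (X × Y) (X × Y) ℂ}
    (hM : M.PosSemidef) : (ptraceFst M).PosSemidef :=
  ptraceFstLin_apply M ▸ (IsCP.sum _ fun _ => IsCP.submatrixLin _).posSemidef hM

theorem Matrix.PosSemidef.ptraceSnd [Fintype Y] {M : Matrix (X × Y) (X × Y) ℂ}
    (hM : M.PosSemidef) : (ptraceSnd M).PosSemidef :=
  ptraceSndLin_apply M ▸ (IsCP.sum _ fun _ => IsCP.submatrixLin _).posSemidef hM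

variable [Fintype X] [Fintype Y]

theorem trace_ptraceFst (M : Matrix (X × Y) (X × Y) ℂ) : (ptraceFst M).trace = M.trace := by
  simp only [ptraceFst, trace, diag, of_apply, Fintype.sum_prod_type]
  exact Finset.sum_comm

theorem trace_ptraceSnd (M : Matrix (X × Y) (X × Y) ℂ) : (ptraceSnd M).trace = M.trace := by
  simp only [ptraceSnd, trace, diag, of_apply, Fintype.sum_prod_type]

theorem IsState.ptraceFst {ρ : Matrix (X × Y) (X × Y) ℂ} (hρ : IsState ρ) :
    IsState (ptraceFst ρ) :=
  ⟨hρ.1.ptraceFst, (trace_ptraceFst ρ).trans hρ.2⟩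

theorem HasTraceNormLE.ptraceFst {M : Matrix (X × Y) (X × Y) ℂ} {c : ℝ} (hM : HasTraceNormLE M c) :
    HasTraceNormLE (ptraceFst M) c := by
  simp only [← ptraceFstLin_apply]
  refine hM.map _ (fun P hP => ?_) fun P _ => ?_
  · simpa only [ptraceFstLin_apply] using hP.ptraceFst
  · rw [ptraceFstLin_apply, trace_ptraceFst]

theorem HasTraceNormLE.ptraceSnd {M : Matrix (X × Y) (X × Y) ℂ} {c : ℝ} (hM : HasTraceNormLE M c) :
    HasTraceNormLE (ptraceSnd M) c := by
  simp only [← ptraceSndLin_apply]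
  refine hM.map _ (fun P hP => ?_) fun P _ => ?_
  · simpa only [ptraceSndLin_apply] using hP.ptraceSnd
  · rw [ptraceSndLin_apply, trace_ptraceSnd]

theorem trace_onFst {m n R : Type} [Fintype m] [Fintype n] [Fintype R]
    {Φ : Matrix m m ℂ →ₗ[ℂ] Matrix n n ℂ} (hΦ : IsTP Φ) (M : Matrix (m × R) (m × R) ℂ) :
    (onFst R Φ M).trace = M.trace := by
  simp only [trace, diag, Fintype.sum_prod_type_right]
  exact Finset.sum_congr rfl fun r _ => hΦ (of fun i j => M (i, r) (j, r))

theorem trace_swapReg {Z : Type} [Fintype Z] (M : Matrix ((X × Y) × Z) ((X × Y) × Z) ℂ) :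
    (swapReg M).trace = M.trace := by
  simp only [trace, diag, Fintype.sum_prod_type, swapReg, submatrix_apply]
  exact Finset.sum_congr rfl fun _ _ => Finset.sum_comm

theorem onSnd_posSemidef {m n R : Type} [Fintype R] {Φ : Matrix m m ℂ →ₗ[ℂ] Matrix n n ℂ}
    (hΦ : IsCP Φ) {M : Matrix (R × m) (R × m) ℂ} (hM : M.PosSemidef) :
    (onSnd R Φ M).PosSemidef :=
  (onFst_posSemidef hΦ (hM.submatrix Prod.swap)).submatrix Prod.swap

theorem ptraceFst_onSnd {m n R : Type} [Fintype R] (Φ : Matrix m m ℂ →ₗ[ℂ] Matrix n n ℂ)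
    (M : Matrix (R × m) (R × m) ℂ) : ptraceFst (onSnd R Φ M) = Φ (ptraceFst M) := by
  have h : ptraceFst M = ∑ r, of fun i j => M (r, i) (r, j) := by
    ext i j
    simp [ptraceFst, Matrix.sum_apply]
  ext i j
  rw [h, map_sum, Matrix.sum_apply]
  rfl

variable {A R : Type}

theorem embedAcc_posSemidef [Fintype A] [DecidableEq A] [Fintype R] [DecidableEq R]
    {M : Matrix (A × R) (A × R) ℂ} (hM : M.PosSemidef) : (embedAcc M).PosSemidef := by
  let J : Matrix (Option A × R) (A × R) ℂ := of fun p q => if p = (some q.1, q.2) then 1 else 0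
  have : embedAcc M = J * M * Jᴴ := by
    ext ⟨a, r⟩ ⟨b, s⟩
    cases a <;> cases b <;>
      simp [embedAcc, J, mul_apply, Fintype.sum_prod_type, ite_and, apply_ite (starRingEnd ℂ)]
  exact this ▸ hM.mul_mul_conjTranspose_same J

theorem ptraceFst_embedAcc [Fintype A] (M : Matrix (A × R) (A × R) ℂ) :
    ptraceFst (embedAcc M) = ptraceFst M := by
  ext i j
  simp [ptraceFst, embedAcc, Fintype.sum_option]

omit [Fintype X] in
theorem ptraceSnd_kronecker (M : Matrix X X ℂ) (N : Matrix Y Y ℂ) :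
    ptraceSnd (M ⊗ₖ N) = N.trace • M := by
  ext i j
  simp [ptraceSnd, trace, ← Finset.mul_sum, mul_comm]

omit [Fintype Y] in
theorem ptraceFst_kronecker (M : Matrix X X ℂ) (N : Matrix Y Y ℂ) :
    ptraceFst (M ⊗ₖ N) = M.trace • N := by
  ext i j
  simp [ptraceFst, trace, ← Finset.sum_mul]

theorem IsState.kronecker {ρ : Matrix X X ℂ} {σ : Matrix Y Y ℂ} (hρ : IsState ρ) (hσ : IsState σ) :
    IsState (ρ ⊗ₖ σ) :=
  ⟨hρ.1.kronecker hσ.1, by rw [trace_kronecker, hρ.2, hσ.2, one_mul]⟩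

end CompletelyPositive

/-! ### Reordering registers and operators acting on part of them. -/

section Registers

variable {X Y Z : Type}

/-- `swapReg` as a linear map. -/
def swapRegLin (X Y Z : Type) :
    Matrix ((X × Y) × Z) ((X × Y) × Z) ℂ →ₗ[ℂ] Matrix ((X × Z) × Y) ((X × Z) × Y) ℂ :=
  submatrixLin fun p => ((p.1.1, p.2), p.1.2)

theorem swapReg_mul [Fintype X] [Fintype Y] [Fintype Z]
    (M N : Matrix ((X × Y) × Z) ((X × Y) × Z) ℂ) :
    swapReg (M * N) = swapReg M * swapReg N := by
  ext p q
  simp only [swapReg, submatrix_apply, mul_apply, Fintype.sum_prod_type]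
  exact Finset.sum_congr rfl fun _ _ => Finset.sum_comm

theorem ptraceSnd_kronecker_one_mul [Fintype X] [Fintype Y] [DecidableEq Y] (U : Matrix X X ℂ)
    (M : Matrix (X × Y) (X × Y) ℂ) :
    ptraceSnd ((U ⊗ₖ (1 : Matrix Y Y ℂ)) * M) = U * ptraceSnd M := by
  ext i j
  simp only [ptraceSnd, of_apply, mul_apply, Fintype.sum_prod_type, kroneckerMap_apply, one_apply,
    mul_ite, mul_one, mul_zero, ite_mul, zero_mul, Finset.sum_ite_eq, Finset.mem_univ, if_true,
    Finset.mul_sum]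
  exact Finset.sum_comm

/-- An observable that ignores `Y` sees only the marginal. This lets an operator on `C B` be paired
with an encryption stored on `C K B`. -/
theorem trace_swapReg_kronecker_one_mul [Fintype X] [Fintype Y] [DecidableEq Y] [Fintype Z]
    (U : Matrix (X × Z) (X × Z) ℂ) (M : Matrix ((X × Y) × Z) ((X × Y) × Z) ℂ) :
    (swapReg (U ⊗ₖ (1 : Matrix Y Y ℂ)) * M).trace = (U * ptraceSnd (swapReg M)).trace := by
  rw [← ptraceSnd_kronecker_one_mul, trace_ptraceSnd, ← trace_swapReg _, swapReg_mul]
  rfl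

theorem kronecker_one_mul_mul_kronecker_one_apply {m n k R : Type} [Fintype m] [Fintype n]
    [Fintype R] [DecidableEq R] (V : Matrix k m ℂ) (W : Matrix n k ℂ)
    (M : Matrix (m × R) (n × R) ℂ) (p q : k × R) :
    ((V ⊗ₖ (1 : Matrix R R ℂ)) * M * (W ⊗ₖ (1 : Matrix R R ℂ))) p q =
      (V * of (fun i j => M (i, p.2) (j, q.2)) * W) p.1 q.1 := by
  simp [mul_apply, Fintype.sum_prod_type, one_apply, Finset.sum_mul]

end Registers

/-! ### Ciphertexts, acceptance and rejection. -/

namespace QES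

variable {A K C : Type} [Fintype A] [DecidableEq A] [Fintype K] [DecidableEq K]
  [Fintype C] [DecidableEq C] (S : QES A K C) {B B' : Type} [Fintype B] [Fintype B']

/-- The encryption `E(ρ_AB ⊗ τ_K)` on the registers `C K B`. -/
def encrypt (B : Type) : Matrix (A × B) (A × B) ℂ →ₗ[ℂ] Matrix ((C × K) × B) ((C × K) × B) ℂ :=
  onFstLin B S.enc ∘ₗ swapRegLin A B K ∘ₗ kroneckerRightLin S.key

/-- The ciphertext `Tr_K E(ρ_AB ⊗ τ_K)` on the registers `C B`. -/
def cipher (B : Type) : Matrix (A × B) (A × B) ℂ →ₗ[ℂ] Matrix (C × B) (C × B) ℂ :=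
  ptraceSndLin (C × B) K ∘ₗ swapRegLin C K B ∘ₗ S.encrypt B

/-- `run` as a linear map. -/
def runLin (Λ : Matrix (C × B) (C × B) ℂ →ₗ[ℂ] Matrix (C × B') (C × B') ℂ) :
    Matrix (A × B) (A × B) ℂ →ₗ[ℂ] Matrix ((Option A × B') × K) ((Option A × B') × K) ℂ :=
  swapRegLin (Option A) K B' ∘ₗ onFstLin B' S.dec ∘ₗ swapRegLin C B' K ∘ₗ onFstLin K Λ ∘ₗ
    swapRegLin C K B ∘ₗ S.encrypt B

omit [Fintype B] in
theorem cipher_apply (ρ : Matrix (A × B) (A × B) ℂ) :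
    S.cipher B ρ = ptraceSnd (swapReg (S.encrypt B ρ)) :=
  ptraceSndLin_apply _

omit [Fintype B] [Fintype B'] in
theorem runLin_apply (Λ : Matrix (C × B) (C × B) ℂ →ₗ[ℂ] Matrix (C × B') (C × B') ℂ)
    (ρ : Matrix (A × B) (A × B) ℂ) : S.runLin Λ ρ = S.run Λ ρ :=
  rfl

theorem isCP_encrypt : IsCP (S.encrypt B) :=
  (IsCP.onFstLin B S.enc_isCPTP.1).comp
    ((IsCP.submatrixLin _).comp (IsCP.kroneckerRightLin S.key_isState.1))

theorem isCP_runLin {Λ : Matrix (C × B) (C × B) ℂ →ₗ[ℂ] Matrix (C × B') (C × B') ℂ} (hΛ : IsCP Λ) :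
    IsCP (S.runLin Λ) :=
  (IsCP.submatrixLin _).comp ((IsCP.onFstLin B' S.dec_isCPTP.1).comp ((IsCP.submatrixLin _).comp
    ((IsCP.onFstLin K hΛ).comp ((IsCP.submatrixLin _).comp S.isCP_encrypt))))

theorem trace_run {Λ : Matrix (C × B) (C × B) ℂ →ₗ[ℂ] Matrix (C × B') (C × B') ℂ} (hΛ : IsTP Λ)
    (ρ : Matrix (A × B) (A × B) ℂ) : (S.run Λ ρ).trace = ρ.trace := by
  rw [run, trace_swapReg, trace_onFst S.dec_isCPTP.2, trace_swapReg, trace_onFst hΛ, trace_swapReg,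
    trace_onFst S.enc_isCPTP.2, trace_swapReg, trace_kronecker, S.key_isState.2, mul_one]

omit [Fintype B] [Fintype B'] in
/-- The attacked ciphertext, without the key, is the marginal of the decryption. -/
theorem ptraceFst_ptraceSnd_run (Λ : Matrix (C × B) (C × B) ℂ →ₗ[ℂ] Matrix (C × B') (C × B') ℂ)
    (ρ : Matrix (A × B) (A × B) ℂ) :
    ptraceFst (ptraceSnd (S.run Λ ρ)) = ptraceFst (Λ (S.cipher B ρ)) := by
  set Z := swapReg (S.encrypt B ρ) with hZ
  have h1 : ptraceSnd Z = ∑ k, of fun i j => Z (i, k) (j, k) := by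
    ext i j
    simp [ptraceSnd, Matrix.sum_apply]
  ext b b'
  rw [cipher_apply, ← hZ, h1, map_sum]
  -- Trace preservation is applied to each block `(b, b')` separately; these blocks need not be
  -- positive.
  have h2 := S.dec_isCPTP.2
    (of fun x y : C × K => swapReg (onFst K Λ Z) (x, b) (y, b'))
  simp only [trace, diag, Fintype.sum_prod_type] at h2
  refine h2.trans ?_
  simp only [ptraceFst, of_apply, Matrix.sum_apply]
  rfl

/-! ### The accepted and the rejected part -/

/-- `Π_acc M Π_acc` for an operator on the registers `(A ⊕ ⊥) B' K`. -/
def accPart (M : Matrix ((Option A × B') × K) ((Option A × B') × K) ℂ) :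
    Matrix ((Option A × B') × K) ((Option A × B') × K) ℂ :=
  of fun p q => if p.1.1.isSome ∧ q.1.1.isSome then M p q else 0

theorem accProj_mul_mul_accProj [DecidableEq B']
    (M : Matrix ((Option A × B') × K) ((Option A × B') × K) ℂ) :
    ((accProj A ⊗ₖ (1 : Matrix B' B' ℂ)) ⊗ₖ (1 : Matrix K K ℂ)) * M *
      ((accProj A ⊗ₖ (1 : Matrix B' B' ℂ)) ⊗ₖ (1 : Matrix K K ℂ)) = accPart M := by
  have h : (accProj A ⊗ₖ (1 : Matrix B' B' ℂ)) ⊗ₖ (1 : Matrix K K ℂ) =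
      diagonal fun p : (Option A × B') × K => if p.1.1.isSome then 1 else 0 := by
    rw [accProj, ← diagonal_one, ← diagonal_one, diagonal_kronecker_diagonal,
      diagonal_kronecker_diagonal]
    simp
  ext p q
  rw [h, mul_diagonal, diagonal_mul, accPart, of_apply]
  by_cases hp : p.1.1.isSome <;> by_cases hq : q.1.1.isSome <;> simp [hp, hq]

theorem accPart_posSemidef [DecidableEq B']
    {M : Matrix ((Option A × B') × K) ((Option A × B') × K) ℂ} (hM : M.PosSemidef) :
    (accPart M).PosSemidef := by
  rw [← accProj_mul_mul_accProj]
  have h : (accProj A)ᴴ = accProj A := by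
    rw [accProj, diagonal_conjTranspose]
    congr 1
    ext x
    cases x <;> simp
  simpa only [conjTranspose_kronecker, h, conjTranspose_one] using
    hM.mul_mul_conjTranspose_same ((accProj A ⊗ₖ (1 : Matrix B' B' ℂ)) ⊗ₖ (1 : Matrix K K ℂ))

/-- The subnormalized state of `B'` after rejection. -/
def rejected (Λ : Matrix (C × B) (C × B) ℂ →ₗ[ℂ] Matrix (C × B') (C × B') ℂ) :
    Matrix (A × B) (A × B) ℂ →ₗ[ℂ] Matrix B' B' ℂ :=
  (∑ k : K, submatrixLin fun b => ((none, b), k)) ∘ₗ S.runLin Λ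

omit [Fintype B] [Fintype B'] in
theorem rejected_apply (Λ : Matrix (C × B) (C × B) ℂ →ₗ[ℂ] Matrix (C × B') (C × B') ℂ)
    (ρ : Matrix (A × B) (A × B) ℂ) (b b' : B') :
    S.rejected Λ ρ b b' = ∑ k, S.run Λ ρ ((none, b), k) ((none, b'), k) := by
  rw [rejected, LinearMap.comp_apply, LinearMap.sum_apply, Matrix.sum_apply]
  rfl

theorem isCP_rejected {Λ : Matrix (C × B) (C × B) ℂ →ₗ[ℂ] Matrix (C × B') (C × B') ℂ}
    (hΛ : IsCP Λ) : IsCP (S.rejected Λ) :=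
  (IsCP.sum _ fun _ => IsCP.submatrixLin _).comp (S.isCP_runLin hΛ)

-- Acceptance and rejection exhaust the outcomes. Secrecy of the ciphertext controls the first term
-- and the GYZ condition the second.
omit [Fintype B] [Fintype B'] in
theorem rejected_eq (Λ : Matrix (C × B) (C × B) ℂ →ₗ[ℂ] Matrix (C × B') (C × B') ℂ)
    (ρ : Matrix (A × B) (A × B) ℂ) :
    S.rejected Λ ρ =
      ptraceFst (Λ (S.cipher B ρ)) - ptraceFst (ptraceSnd (accPart (S.run Λ ρ))) := by
  rw [← ptraceFst_ptraceSnd_run]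
  ext b b'
  simp [rejected_apply, ptraceFst, ptraceSnd, accPart, Fintype.sum_option]

-- The measurement kills the coherences with `⊥`, leaving the block form that a DNS simulator has.
omit [Fintype B] [Fintype B'] in
theorem ptraceSnd_run_withMeasuredRejection
    (Λ : Matrix (C × B) (C × B) ℂ →ₗ[ℂ] Matrix (C × B') (C × B') ℂ)
    (ρ : Matrix (A × B) (A × B) ℂ) :
    ptraceSnd (S.withMeasuredRejection.run Λ ρ) =
      ptraceSnd (accPart (S.run Λ ρ)) + rejProj A ⊗ₖ S.rejected Λ ρ := by
  have h : ∀ p q, S.withMeasuredRejection.run Λ ρ p q =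
      if p.1.1.isSome = q.1.1.isSome then S.run Λ ρ p q else 0 := fun p q =>
    measureBot_apply _ (p.1.1, p.2) (q.1.1, q.2)
  ext ⟨a, b⟩ ⟨a', b'⟩
  cases a <;> cases a' <;> simp [ptraceSnd, h, accPart, rejected_apply, rejProj]

/-- The probability of acceptance of the ciphertext `Y`. -/
def accProb (B : Type) [Fintype B] : Matrix ((C × K) × B) ((C × K) × B) ℂ →ₗ[ℂ] ℂ :=
  traceLinearMap ((A × K) × B) ℂ ℂ ∘ₗ submatrixLin (fun p => ((some p.1.1, p.1.2), p.2)) ∘ₗ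
    onFstLin B S.dec

/-- The probability of rejection of the ciphertext `Y`. -/
def rejProb (B : Type) [Fintype B] : Matrix ((C × K) × B) ((C × K) × B) ℂ →ₗ[ℂ] ℂ :=
  traceLinearMap (K × B) ℂ ℂ ∘ₗ submatrixLin (fun p => ((none, p.1), p.2)) ∘ₗ onFstLin B S.dec

theorem accProb_apply (Y : Matrix ((C × K) × B) ((C × K) × B) ℂ) : S.accProb B Y =
    ∑ p : (A × K) × B, onFst B S.dec Y ((some p.1.1, p.1.2), p.2) ((some p.1.1, p.1.2), p.2) :=
  rfl

theorem rejProb_apply (Y : Matrix ((C × K) × B) ((C × K) × B) ℂ) :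
    S.rejProb B Y = ∑ p : K × B, onFst B S.dec Y ((none, p.1), p.2) ((none, p.1), p.2) :=
  rfl

theorem accProb_add_rejProb (Y : Matrix ((C × K) × B) ((C × K) × B) ℂ) :
    S.accProb B Y + S.rejProb B Y = Y.trace := by
  rw [← trace_onFst S.dec_isCPTP.2, accProb_apply, rejProb_apply]
  simp [trace, Fintype.sum_prod_type, Fintype.sum_option, add_comm]

theorem rejProb_nonneg {Y : Matrix ((C × K) × B) ((C × K) × B) ℂ} (hY : Y.PosSemidef) :
    0 ≤ S.rejProb B Y :=
  ((onFst_posSemidef S.dec_isCPTP.1 hY).submatrix _).trace_nonneg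

/-- An honest ciphertext is never rejected. -/
theorem rejProb_encrypt (ρ : Matrix (A × B) (A × B) ℂ) : S.rejProb B (S.encrypt B ρ) = 0 := by
  rw [rejProb_apply]
  refine Finset.sum_eq_zero fun p _ => ?_
  let ρb : Matrix A A ℂ := of fun i j => ρ (i, p.2) (j, p.2)
  -- Correctness is stated for each key `k`; a classical key state is a combination of these.
  have h : ρb ⊗ₖ S.key = ∑ k, S.key k k • (ρb ⊗ₖ single k k (1 : ℂ)) := by
    have hkey : S.key = ∑ k, S.key k k • single k k (1 : ℂ) := by
      conv_lhs => rw [← S.key_classical.diagonal_diag]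
      ext i j
      simp [Matrix.sum_apply, single_apply, diagonal_apply, ite_and]
    conv_lhs => rw [hkey]
    ext i j
    simp [Matrix.sum_apply, Finset.mul_sum, single_apply]
    exact Finset.sum_congr rfl fun k _ => by split_ifs <;> ring
  have h' : S.dec (S.enc (ρb ⊗ₖ S.key)) (none, p.1) (none, p.1) = 0 := by
    rw [h]
    simp only [map_sum, map_smul, S.correct, Matrix.sum_apply]
    simp [embedAcc]
  exact h'

/-- The rejection functional is positive and vanishes on an honest encryption, hence on its
one-sided multiples, so acceptance carries their whole trace. -/
theorem accProb_mul_encrypt {ρ : Matrix (A × B) (A × B) ℂ} (hρ : ρ.PosSemidef) [DecidableEq B]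
    (M : Matrix ((C × K) × B) ((C × K) × B) ℂ) :
    S.accProb B (M * S.encrypt B ρ) = (M * S.encrypt B ρ).trace ∧
      S.accProb B (S.encrypt B ρ * M) = (M * S.encrypt B ρ).trace := by
  obtain ⟨h1, h2⟩ := (S.isCP_encrypt.posSemidef hρ).map_mul_eq_zero (S.rejProb B)
    (fun P hP => S.rejProb_nonneg hP) (S.rejProb_encrypt ρ) M
  constructor
  · rw [← S.accProb_add_rejProb, h1, add_zero]
  · rw [trace_mul_comm, ← S.accProb_add_rejProb, h2, add_zero]

end QES

/-! ### The attack controlled by a qubit. -/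

section ControlledAttack

variable {Q : Type} [Fintype Q] [DecidableEq Q]

/-- The branch `s` of a controlled `U`: the identity, or `U`. -/
def controlled (U : Matrix Q Q ℂ) (s : Bool) : Matrix Q Q ℂ := if s then U else 1

variable {C B : Type} [Fintype C] [DecidableEq C] [Fintype B] [DecidableEq B]

/-- The attack that applies a Hermitian unitary `U` to `C B`, controlled by a qubit in the state
`(|0⟩ + |1⟩) / √2`, and keeps the qubit. -/
noncomputable def controlledAttack (U : Matrix (C × B) (C × B) ℂ) :
    Matrix (C × B) (C × B) ℂ →ₗ[ℂ] Matrix (C × (B × Bool)) (C × (B × Bool)) ℂ :=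
  (2⁻¹ : ℂ) • conjLin (of fun p q => controlled U p.2.2 (p.1, p.2.1) q)

theorem controlledAttack_apply {U : Matrix (C × B) (C × B) ℂ} (hU : U.IsHermitian)
    (Y : Matrix (C × B) (C × B) ℂ) (p q : C × (B × Bool)) :
    controlledAttack U Y p q =
      2⁻¹ * (controlled U p.2.2 * Y * controlled U q.2.2) (p.1, p.2.1) (q.1, q.2.1) := by
  have h : ∀ s, (controlled U s)ᴴ = controlled U s := by
    rintro (_ | _) <;> simp [controlled, hU.eq]
  conv_rhs => rw [← h q.2.2]
  rfl

theorem isCPTP_controlledAttack {U : Matrix (C × B) (C × B) ℂ} (hU : U.IsHermitian)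
    (hUU : U * U = 1) : IsCPTP (controlledAttack U) := by
  refine ⟨(IsCP.conjLin _).smul (by norm_num [Complex.nonneg_iff]), fun Y => ?_⟩
  have h : (controlledAttack U Y).trace = 2⁻¹ * ((U * Y * U).trace + Y.trace) := by
    simp only [trace, diag, controlledAttack_apply hU, Fintype.sum_prod_type, Fintype.sum_bool,
      ← Finset.mul_sum, ← Finset.sum_add_distrib]
    simp [controlled]
  rw [h, trace_mul_comm, ← Matrix.mul_assoc, hUU, Matrix.one_mul]
  ring

end ControlledAttack

/-! ### Total authentication implies encryption. -/

namespace QES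

variable {A K C : Type} [Fintype A] [DecidableEq A] [Fintype K] [DecidableEq K]
  [Fintype C] [DecidableEq C] (S : QES A K C) {B B' : Type} [Fintype B] [DecidableEq B]
  [Fintype B'] [DecidableEq B']

/-- The off-diagonal blocks `s ≠ s'` are the useful ones: there `U` multiplies the encryption on one
side only. -/
theorem run_controlledAttack_apply {U : Matrix (C × B) (C × B) ℂ} (hU : U.IsHermitian)
    (ρ : Matrix (A × B) (A × B) ℂ) (a a' : Option A) (b b' : B) (s s' : Bool) (k k' : K) :
    S.run (controlledAttack U) ρ ((a, (b, s)), k) ((a', (b', s')), k') =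
      2⁻¹ * onFst B S.dec (swapReg (controlled U s ⊗ₖ (1 : Matrix K K ℂ)) * S.encrypt B ρ *
        swapReg (controlled U s' ⊗ₖ (1 : Matrix K K ℂ))) ((a, k), b) ((a', k'), b') := by
  set Z := swapReg (S.encrypt B ρ) with hZ
  have hY : S.encrypt B ρ = swapReg Z := rfl
  rw [hY, ← swapReg_mul, ← swapReg_mul]
  have h : (of fun x y : C × K => swapReg (onFst K (controlledAttack U) Z) (x, (b, s)) (y, (b', s')))
      = (2⁻¹ : ℂ) • of fun x y => swapReg ((controlled U s ⊗ₖ (1 : Matrix K K ℂ)) * Z *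
          (controlled U s' ⊗ₖ (1 : Matrix K K ℂ))) (x, b) (y, b') := by
    ext x y
    simp only [of_apply, Matrix.smul_apply, swapReg, submatrix_apply,
      kronecker_one_mul_mul_kronecker_one_apply, smul_eq_mul]
    exact controlledAttack_apply hU _ (x.1, (b, s)) (y.1, (b', s'))
  change S.dec (of fun x y => swapReg (onFst K (controlledAttack U) Z) (x, (b, s)) (y, (b', s')))
    (a, k) (a', k') = _
  rw [h, map_smul]
  rfl

/-- After a controlled attack, the coherence of the control qubit reveals the expectation of `U` in
the ciphertext. -/
theorem sum_accPart_run_controlledAttack {U : Matrix (C × B) (C × B) ℂ} (hU : U.IsHermitian)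
    {ρ : Matrix (A × B) (A × B) ℂ} (hρ : ρ.PosSemidef) :
    ∑ p : B × Bool, ptraceFst (ptraceSnd (accPart (S.run (controlledAttack U) ρ)))
      (p.1, !p.2) (p.1, p.2) = (U * S.cipher B ρ).trace := by
  set T : Bool → Matrix ((C × K) × B) ((C × K) × B) ℂ :=
    fun s => swapReg (controlled U s ⊗ₖ (1 : Matrix K K ℂ)) with hT
  have h : ∀ s, ∑ b : B, ptraceFst (ptraceSnd (accPart (S.run (controlledAttack U) ρ)))
      (b, !s) (b, s) = 2⁻¹ * S.accProb B (T (!s) * S.encrypt B ρ * T s) := fun s => by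
    rw [accProb_apply, Finset.mul_sum]
    simp only [Fintype.sum_prod_type_right, ptraceFst, ptraceSnd, of_apply, accPart]
    refine Finset.sum_congr rfl fun b _ => ?_
    simp only [Fintype.sum_option, S.run_controlledAttack_apply hU]
    rw [Finset.sum_comm]
    simp [hT]
  have hfalse : T false = 1 := by
    simp only [hT, controlled, Bool.false_eq_true, if_false, one_kronecker_one]
    exact submatrix_one _ fun p q h => by simp_all [Prod.ext_iff]
  have htrue : (T true * S.encrypt B ρ).trace = (U * S.cipher B ρ).trace := by
    rw [cipher_apply, ← trace_swapReg_kronecker_one_mul]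
    rfl
  -- Each of the two off-diagonal blocks contributes half of the expectation of `U`.
  obtain ⟨h1, h2⟩ := S.accProb_mul_encrypt hρ (T true)
  rw [Fintype.sum_prod_type_right, Fintype.sum_bool, h, h, Bool.not_true, Bool.not_false, hfalse,
    Matrix.one_mul, Matrix.mul_one, h1, h2, htrue]
  ring

/-- The trace norm bounds the expectation of the Pauli operator `σ_x` on a control qubit. -/
theorem _root_.HasTraceNormLE.abs_sum_ptrace_le {X : Type} [Fintype X] [DecidableEq X]
    {M : Matrix ((X × (B × Bool)) × K) ((X × (B × Bool)) × K) ℂ} {c : ℝ} (hM : HasTraceNormLE M c) :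
    |(∑ p : B × Bool, ptraceFst (ptraceSnd M) (p.1, !p.2) (p.1, p.2)).re| ≤ c := by
  -- `π` flips the control bit; its permutation matrix `O` is `σ_x` on the qubit, a Hermitian
  -- unitary.
  let π : (X × (B × Bool)) × K → (X × (B × Bool)) × K :=
    fun p => ((p.1.1, (p.1.2.1, !p.1.2.2)), p.2)
  have hπ : ∀ p, π (π p) = p := fun p => by simp [π]
  let O : Matrix ((X × (B × Bool)) × K) ((X × (B × Bool)) × K) ℂ :=
    of fun p q => if π p = q then 1 else 0
  have hO : O.IsHermitian := by
    ext p q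
    have : π q = p ↔ π p = q := ⟨fun h => h ▸ hπ q, fun h => h ▸ hπ p⟩
    simp [O, this, apply_ite (starRingEnd ℂ)]
  have hmul : ∀ N, O * N = N.submatrix π id := fun N => by
    ext p q
    simp [O, mul_apply]
  have hOO : O * O = 1 := by
    rw [hmul]
    ext p q
    simp [O, hπ, one_apply]
  have h := hM.abs_trace_mul_re_le hO hOO
  have hsum : ∑ p : B × Bool, ptraceFst (ptraceSnd M) (p.1, !p.2) (p.1, p.2) = (O * M).trace := by
    rw [hmul]
    simp only [ptraceFst, ptraceSnd, trace, diag, of_apply, submatrix_apply, π, id]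
    rw [Finset.sum_comm]
    simp only [Fintype.sum_prod_type]
  rwa [hsum]

omit [DecidableEq B] in
theorem isHermitian_acc {Λ : Matrix (C × B) (C × B) ℂ →ₗ[ℂ] Matrix (C × B') (C × B') ℂ}
    (hΛ : IsCPTP Λ) {Λacc : Matrix B B ℂ →ₗ[ℂ] Matrix B' B' ℂ} (hacc : IsCP Λacc)
    {ρ : Matrix (A × B) (A × B) ℂ} (hρ : ρ.PosSemidef) :
    (accPart (S.run Λ ρ) - embedAcc (onSnd A Λacc ρ) ⊗ₖ S.key).IsHermitian :=
  (accPart_posSemidef ((S.isCP_runLin hΛ.1).posSemidef hρ)).isHermitian.sub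
    ((embedAcc_posSemidef (onSnd_posSemidef hacc hρ)).kronecker S.key_isState.1).isHermitian

variable {S}

theorem IsGYZAuthenticating.exists_hasTraceNormLE {ε : ℝ} (hS : S.IsGYZAuthenticating ε)
    {Λ : Matrix (C × B) (C × B) ℂ →ₗ[ℂ] Matrix (C × B') (C × B') ℂ} (hΛ : IsCPTP Λ) :
    ∃ Λacc : Matrix B B ℂ →ₗ[ℂ] Matrix B' B' ℂ, IsCP Λacc ∧
      ∀ ρ : Matrix (A × B) (A × B) ℂ, IsState ρ →
        HasTraceNormLE (accPart (S.run Λ ρ) - embedAcc (onSnd A Λacc ρ) ⊗ₖ S.key) ε := by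
  obtain ⟨Λacc, hacc, h⟩ := hS B B' Λ hΛ
  refine ⟨Λacc, hacc, fun ρ hρ => (hasTraceNormLE_iff (S.isHermitian_acc hΛ hacc hρ.1)).2 ?_⟩
  rw [← accProj_mul_mul_accProj]
  exact h ρ hρ

omit [Fintype B] [DecidableEq B] [Fintype B'] [DecidableEq B'] in
theorem ptraceSnd_sub_kronecker_key (S : QES A K C)
    (M : Matrix ((Option A × B') × K) ((Option A × B') × K) ℂ)
    (N : Matrix (Option A × B') (Option A × B') ℂ) :
    ptraceSnd (M - N ⊗ₖ S.key) = ptraceSnd M - N := by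
  rw [← ptraceSndLin_apply, map_sub, ptraceSndLin_apply, ptraceSndLin_apply, ptraceSnd_kronecker,
    S.key_isState.2, one_smul]

-- Since `Λacc` does not touch `A`, tracing out the plaintext and the key leaves a simulated term
-- that depends on `ρ_B` alone.
omit [Fintype B] [DecidableEq B] [Fintype B'] [DecidableEq B'] in
theorem ptraceFst_ptraceSnd_sub (S : QES A K C)
    (M : Matrix ((Option A × B') × K) ((Option A × B') × K) ℂ)
    (Λacc : Matrix B B ℂ →ₗ[ℂ] Matrix B' B' ℂ) (ρ : Matrix (A × B) (A × B) ℂ) :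
    ptraceFst (ptraceSnd (M - embedAcc (onSnd A Λacc ρ) ⊗ₖ S.key)) =
      ptraceFst (ptraceSnd M) - Λacc (ptraceFst ρ) := by
  rw [ptraceSnd_sub_kronecker_key, ← ptraceFstLin_apply, map_sub, ptraceFstLin_apply,
    ptraceFstLin_apply, ptraceFst_embedAcc, ptraceFst_onSnd]

/-- Total authentication implies encryption: without the key, the ciphertext is independent of the
plaintext. -/
theorem IsGYZAuthenticating.hasTraceNormLE_cipher_sub {ε : ℝ} (hS : S.IsGYZAuthenticating ε)
    {ρ σ : Matrix (A × B) (A × B) ℂ} (hρ : IsState ρ) (hσ : IsState σ)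
    (hρσ : ptraceFst ρ = ptraceFst σ) :
    HasTraceNormLE (S.cipher B ρ - S.cipher B σ) (2 * ε) := by
  have hcp : IsCP (S.cipher B) :=
    (IsCP.sum _ fun _ => IsCP.submatrixLin _).comp ((IsCP.submatrixLin _).comp S.isCP_encrypt)
  refine hasTraceNormLE_of_forall_trace_mul
    ((hcp.posSemidef hρ.1).isHermitian.sub (hcp.posSemidef hσ.1).isHermitian) fun U hU hUU => ?_
  obtain ⟨Λacc, -, h⟩ := hS.exists_hasTraceNormLE (isCPTP_controlledAttack hU hUU)
  -- `Λacc` depends on `U` but not on the input, so the subtracted number is the same for `ρ` and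
  -- `σ`.
  have key : ∀ τ, IsState τ → |((U * S.cipher B τ).trace -
      ∑ p : B × Bool, Λacc (ptraceFst τ) (p.1, !p.2) (p.1, p.2)).re| ≤ ε := fun τ hτ => by
    have := HasTraceNormLE.abs_sum_ptrace_le (h τ hτ)
    rwa [ptraceFst_ptraceSnd_sub, Finset.sum_congr rfl fun p _ => Matrix.sub_apply _ _ _ _,
      Finset.sum_sub_distrib, S.sum_accPart_run_controlledAttack hU hτ.1] at this
  have h1 := (abs_le.1 (key ρ hρ)).2
  have h2 := (abs_le.1 (key σ hσ)).1
  rw [hρσ] at h1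
  rw [Matrix.mul_sub, trace_sub]
  simp only [Complex.sub_re] at h1 h2 ⊢
  linarith

end QES

/-! ### Normalizing positive operators and preparing registers. -/

section States

variable {n m : Type} [Fintype n] [DecidableEq n] [Fintype m]

theorem isState_single (i : n) : IsState (single i i (1 : ℂ)) := by
  refine ⟨?_, by simp⟩
  have : single i i (1 : ℂ) = diagonal (Pi.single i 1) := by rw [diagonal_single]
  rw [this]
  refine PosSemidef.diagonal fun j => ?_
  by_cases h : j = i
  · subst h; simp
  · simp [h]

/-- Authentication speaks of states only; this extends positivity of a linear functional from states
to all positive operators. -/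
theorem Matrix.PosSemidef.exists_isState_smul [Nonempty n] {X : Matrix n n ℂ}
    (hX : X.PosSemidef) : ∃ r : ℂ, 0 ≤ r ∧ ∃ σ, IsState σ ∧ X = r • σ := by
  rcases eq_or_ne X.trace 0 with h | h
  · obtain ⟨i⟩ := ‹Nonempty n›
    refine ⟨0, le_rfl, _, isState_single i, ?_⟩
    rw [zero_smul]
    exact hX.trace_eq_zero_iff.1 h
  · refine ⟨X.trace, hX.trace_nonneg, X.trace⁻¹ • X, ⟨hX.smul ?_, ?_⟩, ?_⟩
    · rw [hX.trace_eq_ofReal, ← Complex.ofReal_inv]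
      exact Complex.zero_le_real.2 (inv_nonneg.2 hX.trace_re_nonneg)
    · rw [trace_smul, smul_eq_mul, inv_mul_cancel₀ h]
    · rw [smul_smul, mul_inv_cancel₀ h, one_smul]

omit [DecidableEq n] in
theorem HasTraceNormLE.kronecker_left {ω : Matrix n n ℂ} (hω : IsState ω) {X : Matrix m m ℂ}
    {c : ℝ} (hX : HasTraceNormLE X c) : HasTraceNormLE (ω ⊗ₖ X) c := by
  obtain ⟨P, N, hP, hN, rfl, hc⟩ := hX
  refine ⟨ω ⊗ₖ P, ω ⊗ₖ N, hω.1.kronecker hP, hω.1.kronecker hN, ?_, ?_⟩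
  · ext p q
    simp [mul_sub]
  · simpa [trace_kronecker, hω.2] using hc

theorem HasTraceNormLE.abs_trace_re_le {X : Matrix n n ℂ} {c : ℝ} (hX : HasTraceNormLE X c) :
    |X.trace.re| ≤ c := by
  simpa using hX.abs_trace_mul_re_le isHermitian_one (mul_one 1)

/-- The map `X ↦ ω ⊗ X` that prepares a register. -/
def prepend (ω : Matrix n n ℂ) : Matrix m m ℂ →ₗ[ℂ] Matrix (n × m) (n × m) ℂ :=
  submatrixLin Prod.swap ∘ₗ kroneckerRightLin ω

omit [Fintype n] [DecidableEq n] [Fintype m] in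
theorem prepend_apply (ω : Matrix n n ℂ) (X : Matrix m m ℂ) : prepend ω X = ω ⊗ₖ X := by
  ext p q
  exact mul_comm _ _

omit [DecidableEq n] in
theorem isCP_prepend {ω : Matrix n n ℂ} (hω : ω.PosSemidef) : IsCP (prepend (m := m) ω) :=
  (IsCP.submatrixLin _).comp (IsCP.kroneckerRightLin hω)

end States

theorem isCPTP_id {n : Type} [Fintype n] :
    IsCPTP (LinearMap.id : Matrix n n ℂ →ₗ[ℂ] Matrix n n ℂ) :=
  ⟨fun _ _ hX => hX, fun _ => rfl⟩

/-! ### The rejected state and the DNS simulators. -/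

namespace QES

variable {A K C : Type} [Fintype A] [DecidableEq A] [Fintype K] [DecidableEq K]
  [Fintype C] [DecidableEq C] {S : QES A K C} {B B' : Type} [Fintype B] [DecidableEq B]
  [Fintype B'] [DecidableEq B'] {ε : ℝ}

theorem IsGYZAuthenticating.nonneg [Nonempty A] (hS : S.IsGYZAuthenticating ε) : 0 ≤ ε := by
  obtain ⟨a⟩ := ‹Nonempty A›
  obtain ⟨_, -, h⟩ := hS.exists_hasTraceNormLE (B := Unit) (isCPTP_id (n := C × Unit))
  exact (abs_nonneg _).trans (h _ (isState_single (a, ()))).abs_trace_re_le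

/-- Total authentication implies that the state after a rejection is independent of the plaintext. -/
theorem IsGYZAuthenticating.hasTraceNormLE_rejected_sub (hS : S.IsGYZAuthenticating ε)
    {Λ : Matrix (C × B) (C × B) ℂ →ₗ[ℂ] Matrix (C × B') (C × B') ℂ} (hΛ : IsCPTP Λ)
    {ρ σ : Matrix (A × B) (A × B) ℂ} (hρ : IsState ρ) (hσ : IsState σ)
    (hρσ : ptraceFst ρ = ptraceFst σ) :
    HasTraceNormLE (S.rejected Λ ρ - S.rejected Λ σ) (4 * ε) := by
  obtain ⟨Λacc, -, h⟩ := hS.exists_hasTraceNormLE hΛ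
  have h1 := ((hS.hasTraceNormLE_cipher_sub hρ hσ hρσ).map Λ (fun P hP => hΛ.1.posSemidef hP)
    fun P _ => (congr_arg Complex.re (hΛ.2 P)).le).ptraceFst
  have h2 := (h ρ hρ).ptraceSnd.ptraceFst
  have h3 := (h σ hσ).ptraceSnd.ptraceFst
  -- The cost is `2ε` for the ciphertexts and `ε` for each of the two accepted parts.
  convert (h1.sub h2).add h3 using 1
  · rw [ptraceFst_ptraceSnd_sub, ptraceFst_ptraceSnd_sub, rejected_eq, rejected_eq, hρσ, map_sub,
      ← ptraceFstLin_apply (_ - _), map_sub, ptraceFstLin_apply, ptraceFstLin_apply]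
    abel
  · ring

omit [DecidableEq B] [DecidableEq B'] in
theorem trace_rejected {Λ : Matrix (C × B) (C × B) ℂ →ₗ[ℂ] Matrix (C × B') (C × B') ℂ}
    (hΛ : IsTP Λ) (ρ : Matrix (A × B) (A × B) ℂ) :
    (S.rejected Λ ρ).trace = ρ.trace - (accPart (S.run Λ ρ)).trace := by
  rw [rejected_eq, trace_sub, ← ptraceFst_ptraceSnd_run, trace_ptraceFst, trace_ptraceSnd,
    trace_ptraceFst, trace_ptraceSnd, S.trace_run hΛ]

/-- The budget is `ε` for GYZ and `ε` for rescaling on the accepted side; `4ε` for replacing the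
plaintext, `ε` for rescaling and `2ε` for the trace defect on the rejected side. -/
theorem IsGYZAuthenticating.withMeasuredRejection [Nonempty A] (hS : S.IsGYZAuthenticating ε) :
    S.withMeasuredRejection.IsDNSAuthenticating (9 * ε) := by
  have hε := hS.nonneg
  intro B B' _ _ _ _ Λ hΛ
  rcases isEmpty_or_nonempty B with hB | ⟨⟨b⟩⟩
  · exact ⟨0, 0, IsCP.zero, IsCP.zero, fun X => by simp [trace],
      fun ρ hρ => absurd hρ.2 (by simp [trace])⟩
  obtain ⟨a⟩ := ‹Nonempty A›
  have hB : Nonempty B := ⟨b⟩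
  -- The run preserves the trace, so an output register of dimension zero is impossible.
  have hB' : Nonempty B' := by
    by_contra h
    rw [not_nonempty_iff] at h
    have := S.trace_run hΛ.2 (single (a, b) (a, b) 1)
    simp [trace] at this
  obtain ⟨b'⟩ := hB'
  obtain ⟨Λacc, hacc, h⟩ := hS.exists_hasTraceNormLE hΛ
  have hα := isState_single a
  have hω := isState_single b'
  set α : Matrix A A ℂ := single a a 1
  set ω : Matrix B' B' ℂ := single b' b' 1
  -- The simulator encrypts the fixed plaintext `α` itself and outputs the rejected part.
  set Rej : Matrix B B ℂ →ₗ[ℂ] Matrix B' B' ℂ := S.rejected Λ ∘ₗ prepend α with hRejdef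
  have hRej : IsCP Rej := (S.isCP_rejected hΛ.1).comp (isCP_prepend hα.1)
  have hRej_apply : ∀ σ, Rej σ = S.rejected Λ (α ⊗ₖ σ) := fun σ => by
    rw [hRejdef, LinearMap.comp_apply, prepend_apply]
  -- The traces of `Λacc` and `Rej` on a state sum to at most `1 + ε`; scaling by `c` makes the
  -- trace defect nonnegative.
  set c : ℝ := (1 + ε)⁻¹
  have hc0 : 0 ≤ c := by positivity
  have hc1 : c * (1 + ε) = 1 := inv_mul_cancel₀ (by positivity)
  -- The defect of the trace, which is put on a fixed state.
  let t : Matrix B B ℂ →ₗ[ℂ] ℂ := traceLinearMap B ℂ ℂ -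
    (c : ℂ) • (traceLinearMap B' ℂ ℂ ∘ₗ Λacc + traceLinearMap B' ℂ ℂ ∘ₗ Rej)
  have ht_apply : ∀ X, t X = X.trace - c * ((Λacc X).trace + (Rej X).trace) := fun X => rfl
  -- On `α ⊗ σ` the true acceptance and rejection probabilities sum to `1`, and the GYZ condition
  -- moves the former by at most `ε`.
  have hbound : ∀ σ, IsState σ → |(Λacc σ).trace.re + (Rej σ).trace.re - 1| ≤ ε ∧
      (Rej σ).trace.re ≤ 1 := fun σ hσ => by
    have hασ := hα.kronecker hσ
    have hpos := (accPart_posSemidef ((S.isCP_runLin hΛ.1).posSemidef hασ.1)).trace_re_nonneg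
    have h1 := (h _ hασ).ptraceSnd.ptraceFst.abs_trace_re_le
    have h2 := congr_arg Complex.re (S.trace_rejected hΛ.2 (α ⊗ₖ σ))
    rw [ptraceFst_ptraceSnd_sub, trace_sub, trace_ptraceFst, trace_ptraceSnd, ptraceFst_kronecker,
      hα.2, one_smul, Complex.sub_re, abs_sub_comm] at h1
    rw [hασ.2, Complex.sub_re, Complex.one_re, ← hRej_apply] at h2
    rw [runLin_apply] at hpos
    constructor
    · convert h1 using 2
      linarith
    · linarith
  -- The upper bound is `1 - (1 - ε)/(1 + ε) ≤ 2ε`.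
  have ht : ∀ σ, IsState σ → t σ = ((t σ).re : ℂ) ∧ 0 ≤ (t σ).re ∧ (t σ).re ≤ 2 * ε := by
    intro σ hσ
    obtain ⟨h1, -⟩ := hbound σ hσ
    rw [ht_apply, hσ.2, (hacc.posSemidef hσ.1).trace_eq_ofReal,
      (hRej.posSemidef hσ.1).trace_eq_ofReal]
    norm_cast
    refine ⟨rfl, ?_, ?_⟩ <;> rw [abs_le] at h1 <;> nlinarith
  have htpos : ∀ X, X.PosSemidef → 0 ≤ t X := fun X hX => by
    obtain ⟨r, hr, σ, hσ, rfl⟩ := hX.exists_isState_smul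
    obtain ⟨h1, h2, -⟩ := ht σ hσ
    rw [map_smul, smul_eq_mul, h1]
    exact mul_nonneg hr (Complex.zero_le_real.2 h2)
  have hcC : (0 : ℂ) ≤ c := Complex.zero_le_real.2 hc0
  refine ⟨(c : ℂ) • Λacc, (c : ℂ) • Rej + t.smulRight ω, hacc.smul hcC,
    (hRej.smul hcC).add (IsCP.smulRight htpos hω.1), fun X => ?_, fun ρ hρ => ?_⟩
  · simp only [LinearMap.add_apply, LinearMap.smul_apply, LinearMap.smulRight_apply, trace_add,
      trace_smul, hω.2, ht_apply, smul_eq_mul]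
    ring
  · have hρB := hρ.ptraceFst
    obtain ⟨h1, h2⟩ := hbound _ hρB
    obtain ⟨h3, h4, h5⟩ := ht _ hρB
    set E := embedAcc (onSnd A Λacc ρ) with hE
    have hEpos : E.PosSemidef := embedAcc_posSemidef (onSnd_posSemidef hacc hρ.1)
    have hcE : embedAcc (onSnd A ((c : ℂ) • Λacc) ρ) = (c : ℂ) • E := by
      ext ⟨x, i⟩ ⟨y, j⟩
      cases x <;> cases y <;> simp [hE, embedAcc, onSnd]
    have hc1' : (0 : ℂ) ≤ ((1 - c : ℝ) : ℂ) := Complex.zero_le_real.2 (by nlinarith)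
    have hrej : S.rejected Λ (α ⊗ₖ ptraceFst ρ) = Rej (ptraceFst ρ) := (hRej_apply _).symm
    have e1 := (h ρ hρ).ptraceSnd
    rw [ptraceSnd_sub_kronecker_key, ← hE] at e1
    -- Here `1 - c = cε` and `Tr E ≤ 1 + ε`, so the product is at most `ε`.
    have e2 : HasTraceNormLE (((1 - c : ℝ) : ℂ) • E) ε := by
      refine .of_posSemidef (hEpos.smul hc1') ?_
      have : E.trace.re = (Λacc (ptraceFst ρ)).trace.re := by
        rw [← trace_ptraceFst, hE, ptraceFst_embedAcc, ptraceFst_onSnd]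
      rw [trace_smul, smul_eq_mul, Complex.re_ofReal_mul, this]
      have := (hRej.posSemidef hρB.1).trace_re_nonneg
      rw [abs_le] at h1
      nlinarith
    have e3 := hS.hasTraceNormLE_rejected_sub hΛ hρ (hα.kronecker hρB)
      (by rw [ptraceFst_kronecker, hα.2, one_smul])
    rw [hrej] at e3
    have e4 : HasTraceNormLE (((1 - c : ℝ) : ℂ) • Rej (ptraceFst ρ)) ε := by
      refine .of_posSemidef ((hRej.posSemidef hρB.1).smul hc1') ?_
      rw [trace_smul, smul_eq_mul, Complex.re_ofReal_mul]
      nlinarith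
    have e5 : HasTraceNormLE (t (ptraceFst ρ) • ω) (2 * ε) := by
      refine .of_posSemidef (hω.1.smul (htpos _ hρB.1)) ?_
      rwa [trace_smul, hω.2, smul_eq_mul, mul_one]
    have e := (e1.add e2).add (((e3.add e4).sub e5).kronecker_left
      (isState_single (none : Option A)))
    have hsum : ptraceSnd (S.withMeasuredRejection.run Λ ρ) -
        (embedAcc (onSnd A ((c : ℂ) • Λacc) ρ) + rejProj A ⊗ₖ
          ((c : ℂ) • Rej + t.smulRight ω) (ptraceFst ρ)) =
        ptraceSnd (accPart (S.run Λ ρ)) - E + ((1 - c : ℝ) : ℂ) • E + single none none 1 ⊗ₖ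
          (S.rejected Λ ρ - Rej (ptraceFst ρ) + ((1 - c : ℝ) : ℂ) • Rej (ptraceFst ρ) -
            t (ptraceFst ρ) • ω) := by
      rw [ptraceSnd_run_withMeasuredRejection, hcE]
      ext p q
      simp only [rejProj, Matrix.add_apply, Matrix.sub_apply, Matrix.smul_apply, smul_eq_mul,
        kroneckerMap_apply, LinearMap.add_apply, LinearMap.smul_apply, LinearMap.smulRight_apply]
      push_cast
      ring
    rw [hsum]
    exact (hasTraceNormLE_iff e.isHermitian).1 (e.mono (by linarith))

theorem withMeasuredRejection_eq (h : S.MeasuresRejection) : S.withMeasuredRejection = S := by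
  cases S
  simp only [QES.withMeasuredRejection, QES.mk.injEq, true_and]
  exact h

theorem IsDNSAuthenticating.mono {δ δ' : ℝ} (h : S.IsDNSAuthenticating δ) (hδ : δ ≤ δ') :
    S.IsDNSAuthenticating δ' := fun B B' _ _ _ _ Λ hΛ => by
  obtain ⟨Λacc, Λrej, h1, h2, h3, h4⟩ := h B B' Λ hΛ
  exact ⟨Λacc, Λrej, h1, h2, h3, fun ρ hρ => (h4 ρ hρ).trans hδ⟩

end QES

theorem mainTheorem7 {A K C : Type} [Fintype A] [DecidableEq A] [Nonempty A]
    [Fintype K] [DecidableEq K] [Fintype C] [DecidableEq C]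
    (S : QES A K C) (ε : ℝ) (hε : ε ≤ ((62 : ℝ) ^ 2)⁻¹) (hS : S.IsGYZAuthenticating ε) :
    S.withMeasuredRejection.IsDNSAuthenticating (4 * (28 * √ε + 3 * ε)) ∧
      (S.MeasuresRejection → S.IsDNSAuthenticating (4 * (28 * √ε + 3 * ε))) := by
  -- The `12ε` term of the target already dominates `9ε`.
  have h := hS.withMeasuredRejection.mono (δ' := 4 * (28 * √ε + 3 * ε))
    (by linarith [Real.sqrt_nonneg ε, hS.nonneg])
  exact ⟨h, fun hM => QES.withMeasuredRejection_eq hM ▸ h⟩
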